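/- Formulae are built from variables $p_0, p_1, \ldots$ and the constant $\mathbf{1}$ by the binary connectives $\backslash$ and $\wedge$. A sequent $A_1,\ldots,A_n \vdash B$ consists of a finite, possibly empty, sequence of formulae $A_1,\ldots,A_n$ and a formula $B$. An L$\varepsilon$-model consists of an alphabet $\Sigma$ and a map $w$ assigning to each variable a language $w(p_i)\subseteq\Sigma^*$; $w$ is extended to all formulae by $w(\mathbf{1})=\{\varepsilon\}$, $w(A\wedge B)=w(A)\cap w(B)$ and $w(A\backslash B)=\{u\in\Sigma^* \mid vu\in w(B)\text{ for all } v\in w(A)\}$. The sequent $A_1,\ldots,A_n\vdash B$ is true in the model if $w(A_1)\cdots w(A_n)\subseteq w(B)$ (for $n=0$: if $\varepsilon\in w(B)$). An LReg$\varepsilon$-model is an L$\varepsilon$-model in which every $w(p_i)$ is a regular language, that is, the language of a regular expression over $\Sigma$. For a class $\mathcal{K}$ of models let $\mathrm{Th}(\mathcal{K};\backslash,\wedge,\mathbf{1})$ be the set of all sequents that are true in all models of $\mathcal{K}$. Theorem. $$\mathrm{Th}(\text{LReg}\varepsilon\text{-models};\backslash,\wedge,\mathbf{1})\ \neq\ \mathrm{Th}(\text{L}\varepsilon\text{-models};\backslash,\wedge,\mathbf{1}).$$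 This holds both when arbitrary alphabets $\Sigma$ are allowed (in both classes) and when all alphabets are required to be finite (in both classes). -/

import Mathlib

universe u

namespace Lambek

/-- Formulae in the language of left division, additive conjunction and the unit,
over a countably infinite set of variables. -/
inductive Formula : Type
  | var : ℕ → Formula
  | one : Formula
  | ldiv : Formula → Formula → Formula
  | and : Formula → Formula → Formula

/-- A sequent `A₁, …, Aₙ ⊢ B`; the antecedent is a finite, possibly empty, sequence. -/
structure Sequent : Type where
  antecedent : List Formula
  succedent : Formula

/-- Left division of languages: all words `x` such that `v x ∈ B` for every `v ∈ A`. -/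
def leftDiv {α : Type u} (A B : Language α) : Language α :=
  {x : List α | ∀ v ∈ A, v ++ x ∈ B}

/-- A language model with the empty word allowed: an alphabet, and a language over it for each
variable. -/
structure Model : Type (u + 1) where
  Alphabet : Type u
  val : ℕ → Language Alphabet

namespace Model

/-- The interpretation of formulae; `1` on languages is the language `{ε}`, and `⊓` is
intersection. -/
def interp (M : Model.{u}) : Formula → Language M.Alphabet
  | .var i => M.val i
  | .one => 1
  | .ldiv A B => leftDiv (M.interp A) (M.interp B)
  | .and A B => M.interp A ⊓ M.interp B

/-- Truth of a sequent: the product of the interpretations of the antecedent formulae is included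
in the interpretation of the succedent. The empty product is `{ε}`. -/
def Satisfies (M : Model.{u}) (s : Sequent) : Prop :=
  (s.antecedent.map M.interp).prod ≤ M.interp s.succedent

/-- Every variable is interpreted by the language of some regular expression. -/
def IsRegular (M : Model.{u}) : Prop :=
  ∀ i, ∃ R : RegularExpression M.Alphabet, R.matches' = M.val i

end Model

/-- The complete theory of a class of models: all sequents true in all models of the class. -/
def Th (K : Set Model.{u}) : Set Sequent :=
  {s | ∀ M ∈ K, M.Satisfies s}

end Lambek

/-! ### Regular languages have finitely many left quotients -/

namespace Language

open scoped Computability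

variable {α : Type*}

/-! Since `ε ∈ A\B` iff `A ⊆ B`, and `1 ∧ A` retains only the test `ε ∈ A`, a sequent can state an
implication between inclusions. `separatingSequent` puts `PⁿQⁿ` in `E`, `PᵐQⁿ` for `m < n` in `F`,
and `E ∩ F` in `R`. If `E` is regular it has finitely many left quotients, so pigeonhole
(`exists_lt_append_mem`) yields `PᵐQⁿ ⊆ E ∩ F ⊆ R` for some `m < n`, and cancellation gives `ε ∈ R`.
The nonregular `E = {aⁿbⁿ}` is disjoint from `F`, so `R = ∅` refutes the sequent, already over two
letters. -/

theorem finite_range_leftQuotient_add {L M : Language α}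
    (hL : (Set.range L.leftQuotient).Finite) (hM : (Set.range M.leftQuotient).Finite) :
    (Set.range (L + M).leftQuotient).Finite := by
  refine (hL.image2 (· + ·) hM).subset ?_
  rintro _ ⟨x, rfl⟩
  exact ⟨_, ⟨x, rfl⟩, _, ⟨x, rfl⟩, rfl⟩

/-- `x⁻¹(LM)` is `(x⁻¹L)M` together with all `y⁻¹M` for `x = ay`, `a ∈ L`: it is determined by one
quotient of `L` and a set of quotients of `M`. -/
theorem finite_range_leftQuotient_mul {L M : Language α}
    (hL : (Set.range L.leftQuotient).Finite) (hM : (Set.range M.leftQuotient).Finite) :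
    (Set.range (L * M).leftQuotient).Finite := by
  refine (hL.image2 (fun (N : Language α) (T : Set (Language α)) => N * M + sSup T)
    hM.finite_subsets).subset ?_
  rintro _ ⟨x, rfl⟩
  refine ⟨_, ⟨x, rfl⟩, {N | ∃ a ∈ L, ∃ y, x = a ++ y ∧ M.leftQuotient y = N}, ?_, ?_⟩
  · rintro _ ⟨a, -, y, -, rfl⟩
    exact ⟨y, rfl⟩
  · ext z
    rw [mem_add, mem_leftQuotient, mem_mul, mem_mul]
    constructor
    · rintro (⟨a, ha, b, hb, rfl⟩ | ⟨_, ⟨a, ha, y, rfl, rfl⟩, hz⟩)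
      · exact ⟨x ++ a, ha, b, hb, List.append_assoc ..⟩
      · exact ⟨a, ha, y ++ z, hz, (List.append_assoc ..).symm⟩
    · rintro ⟨a, ha, b, hb, h⟩
      obtain ⟨c, rfl, rfl⟩ | ⟨c, rfl, rfl⟩ := List.append_eq_append_iff.1 h
      · exact Or.inr ⟨_, ⟨a, ha, c, rfl, rfl⟩, hb⟩
      · exact Or.inl ⟨c, ha, b, hb, rfl⟩

/-- A nonempty prefix of a word of `L∗` ends inside, or at the end of, one of the factors. -/
theorem exists_split_of_append_mem_kstar {L : Language α} {x z : List α} (hx : x ≠ [])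
    (h : x ++ z ∈ L∗) :
    ∃ a ∈ L∗, ∃ y, x = a ++ y ∧ z ∈ L.leftQuotient y * L∗ := by
  obtain ⟨S, hS, hmem⟩ := mem_kstar.1 h
  clear h
  induction S generalizing x with
  | nil => simp_all
  | cons s S ih =>
    have hs : s ∈ L := hmem s (by simp)
    have hSL : ∀ y ∈ S, y ∈ L := fun y hy => hmem y (by simp [hy])
    rw [List.flatten_cons] at hS
    obtain ⟨c, rfl, rfl⟩ | ⟨c, rfl, hc⟩ := List.append_eq_append_iff.1 hS
    · exact ⟨[], nil_mem_kstar L, x, rfl, append_mem_mul hs (join_mem_kstar hSL)⟩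
    · by_cases hc0 : c = []
      · subst hc0
        -- The prefix ends exactly with the factor `s`, so `ε ∈ s⁻¹L`.
        refine ⟨[], nil_mem_kstar L, s ++ [], rfl, mem_mul.2 ⟨[], by simpa using hs, z, ?_, rfl⟩⟩
        rw [List.nil_append] at hc
        exact hc ▸ join_mem_kstar hSL
      · obtain ⟨a, ha, y, rfl, hz⟩ := ih hc0 hc.symm hSL
        refine ⟨s ++ a, ?_, y, by simp, hz⟩
        rw [← one_add_self_mul_kstar_eq_kstar]
        exact Or.inr (append_mem_mul hs ha)

theorem finite_range_leftQuotient_kstar {L : Language α}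
    (hL : (Set.range L.leftQuotient).Finite) : (Set.range L∗.leftQuotient).Finite := by
  refine ((hL.finite_subsets.image (fun T : Set (Language α) => sSup T * L∗)).insert L∗).subset ?_
  rintro _ ⟨x, rfl⟩
  -- For `x = ε` the formula below would give `LL∗`, which may lack `ε`.
  by_cases hx : x = []
  · exact Or.inl (hx ▸ rfl)
  refine Or.inr ⟨{N | ∃ a ∈ L∗, ∃ y, x = a ++ y ∧ L.leftQuotient y = N}, ?_, ?_⟩
  · rintro _ ⟨a, -, y, -, rfl⟩
    exact ⟨y, rfl⟩
  · ext z
    rw [mem_leftQuotient]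
    constructor
    · intro h
      obtain ⟨b, ⟨_, ⟨a, ha, y, rfl, rfl⟩, hb⟩, c, hc, rfl⟩ := mem_mul.1 h
      have hbc : (y ++ b) ++ c ∈ L∗ := by
        rw [← one_add_self_mul_kstar_eq_kstar]
        exact Or.inr (append_mem_mul hb hc)
      have := append_mem_mul ha hbc
      rw [kstar_mul_kstar] at this
      simpa using this
    · intro h
      obtain ⟨a, ha, y, hy, hz⟩ := exists_split_of_append_mem_kstar hx h
      obtain ⟨b, hb, c, hc, rfl⟩ := mem_mul.1 hz
      exact append_mem_mul ⟨_, ⟨a, ha, y, hy, rfl⟩, hb⟩ hc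

/-- Every quotient is a subset of the finite set of suffixes of words of `L`. -/
theorem finite_range_leftQuotient_of_finite {L : Language α} (hL : Set.Finite (L : Set (List α))) :
    (Set.range L.leftQuotient).Finite := by
  have hsuf : (⋃ w ∈ (L : Set (List α)), {y : List α | y <:+ w}).Finite :=
    hL.biUnion fun w _ => (List.finite_toSet w.tails).subset fun y hy => (List.mem_tails y w).2 hy
  refine hsuf.finite_subsets.subset ?_
  rintro _ ⟨x, rfl⟩ y hy
  exact Set.mem_biUnion (show x ++ y ∈ (L : Set (List α)) from hy) (List.suffix_append x y)

end Language

theorem RegularExpression.finite_range_leftQuotient {α : Type*} (R : RegularExpression α) :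
    (Set.range R.matches'.leftQuotient).Finite := by
  induction R with
  | zero => exact Language.finite_range_leftQuotient_of_finite Set.finite_empty
  | epsilon => exact Language.finite_range_leftQuotient_of_finite (Set.finite_singleton [])
  | char a => exact Language.finite_range_leftQuotient_of_finite (Set.finite_singleton [a])
  | plus P Q hP hQ => exact Language.finite_range_leftQuotient_add hP hQ
  | comp P Q hP hQ => exact Language.finite_range_leftQuotient_mul hP hQ
  | star P hP => exact Language.finite_range_leftQuotient_kstar hP

/-! ### The separating sequent -/

namespace Lambek

theorem nil_mem_leftDiv {α : Type u} {A B : Language α} : [] ∈ leftDiv A B ↔ A ≤ B := by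
  constructor
  · intro h v hv
    exact List.append_nil v ▸ h v hv
  · intro h v hv
    exact (List.append_nil v).symm ▸ h hv

/-- The sequent expressing that if `ε` belongs to all languages in `l`, then it belongs to `B`. -/
def testSequent (l : List Formula) (B : Formula) : Sequent :=
  ⟨l.map (Formula.and .one), B⟩

theorem Model.prod_interp_tests (M : Model.{u}) (l : List Formula) (w : List M.Alphabet) :
    w ∈ ((l.map (Formula.and .one)).map M.interp).prod ↔
      w = [] ∧ ∀ A ∈ l, [] ∈ M.interp A := by
  induction l generalizing w with
  | nil => simp [Language.mem_one]
  | cons A l ih =>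
    simp only [List.map_cons, List.prod_cons, Language.mem_mul, ih, List.forall_mem_cons]
    constructor
    · rintro ⟨a, ⟨ha, ha'⟩, b, ⟨rfl, hb⟩, rfl⟩
      obtain rfl : a = [] := ha
      exact ⟨rfl, ha', hb⟩
    · rintro ⟨rfl, hA, hl⟩
      exact ⟨[], ⟨rfl, hA⟩, [], ⟨rfl, hl⟩, rfl⟩

theorem Model.satisfies_testSequent (M : Model.{u}) (l : List Formula) (B : Formula) :
    M.Satisfies (testSequent l B) ↔ ((∀ A ∈ l, [] ∈ M.interp A) → [] ∈ M.interp B) := by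
  constructor
  · intro h hl
    exact h ((M.prod_interp_tests l []).2 ⟨rfl, hl⟩)
  · intro h w hw
    obtain ⟨rfl, hl⟩ := (M.prod_interp_tests l w).1 hw
    exact h hl

/-- With `P, Q, E, F, R` the variables `0, …, 4`, this says that `ε ∈ R` provided that `E` contains
all `PⁿQⁿ`, `F` contains all `PᵐQⁿ` with `m < n`, `E ∩ F ⊆ R`, and `R` is closed under cancelling
`P` and `Q` on the left. -/
def separatingSequent : Sequent :=
  testSequent
    [.var 2,
     .ldiv (.var 1) (.ldiv (.var 2) (.ldiv (.var 0) (.var 2))),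
     .ldiv (.var 1) (.var 3),
     .ldiv (.var 1) (.ldiv (.var 3) (.var 3)),
     .ldiv (.var 1) (.ldiv (.var 3) (.ldiv (.var 0) (.var 3))),
     .ldiv (.and (.var 2) (.var 3)) (.var 4),
     .ldiv (.ldiv (.var 0) (.var 4)) (.var 4),
     .ldiv (.ldiv (.var 1) (.var 4)) (.var 4)]
    (.var 4)

section

variable {α : Type u} {P Q E F R : Language α}

theorem append_mem_of_mem_pow (h1 : [] ∈ E) (h2 : Q ≤ leftDiv E (leftDiv P E)) (n : ℕ)
    {u v : List α} (hu : u ∈ P ^ n) (hv : v ∈ Q ^ n) : u ++ v ∈ E := by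
  induction n generalizing u v with
  | zero =>
    obtain rfl : u = [] := hu
    obtain rfl : v = [] := hv
    exact h1
  | succ n ih =>
    rw [pow_succ'] at hu
    rw [pow_succ] at hv
    obtain ⟨p, hp, u, hu', rfl⟩ := Language.mem_mul.1 hu
    obtain ⟨v, hv', q, hq, rfl⟩ := Language.mem_mul.1 hv
    simpa using h2 hq _ (ih hu' hv') p hp

theorem append_mem_of_mem_pow_of_lt (h3 : Q ≤ F) (h4 : Q ≤ leftDiv F F)
    (h5 : Q ≤ leftDiv F (leftDiv P F)) {m n : ℕ} (hmn : m < n)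
    {u v : List α} (hu : u ∈ P ^ m) (hv : v ∈ Q ^ n) : u ++ v ∈ F := by
  obtain ⟨k, rfl⟩ := Nat.exists_eq_add_of_lt hmn
  clear hmn
  induction m generalizing u v with
  | zero =>
    obtain rfl : u = [] := hu
    rw [zero_add] at hv
    rw [List.nil_append]
    induction k generalizing v with
    | zero => exact h3 (pow_one Q ▸ hv)
    | succ k ih =>
      rw [pow_succ] at hv
      obtain ⟨v, hv', q, hq, rfl⟩ := Language.mem_mul.1 hv
      exact h4 hq _ (ih hv')
  | succ m ih =>
    rw [pow_succ'] at hu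
    rw [show m + 1 + k + 1 = m + k + 1 + 1 by omega, pow_succ] at hv
    obtain ⟨p, hp, u, hu', rfl⟩ := Language.mem_mul.1 hu
    obtain ⟨v, hv', q, hq, rfl⟩ := Language.mem_mul.1 hv
    simpa using h5 hq _ (ih hu' hv') p hp

/-- Each use of `h` strips one outer factor `P`. `P` may be empty: then `leftDiv P R` contains every
word, hence so does `R`. -/
theorem mem_of_pow_append_mem (h : leftDiv P R ≤ R) (n : ℕ) {v : List α}
    (hv : ∀ u ∈ P ^ n, u ++ v ∈ R) : v ∈ R := by
  induction n with
  | zero => exact hv [] rfl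
  | succ n ih =>
    refine ih fun u hu => h fun p hp => ?_
    rw [← List.append_assoc]
    exact hv _ (pow_succ' P n ▸ Language.append_mem_mul hp hu)

/-- If `E` has finitely many left quotients and contains all `PⁿQⁿ`, then it contains `PᵐQⁿ` for
some `m < n`. -/
theorem exists_lt_append_mem (hE : (Set.range E.leftQuotient).Finite)
    (h : ∀ n, ∀ u ∈ P ^ n, ∀ v ∈ Q ^ n, u ++ v ∈ E) :
    ∃ m n, m < n ∧ ∀ u ∈ P ^ m, ∀ v ∈ Q ^ n, u ++ v ∈ E := by
  -- `P` need not be a single word, so the pigeonhole compares the sets of quotients by all words of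
  -- `Pⁿ`.
  let T : ℕ → Set (Language α) := fun n => E.leftQuotient '' (P ^ n : Language α)
  obtain ⟨m, n, hmn, hT⟩ := hE.finite_subsets.exists_lt_map_eq_of_forall_mem (f := T)
    fun n => Set.image_subset_range _ _
  refine ⟨m, n, hmn, fun u hu v hv => ?_⟩
  have hmem : E.leftQuotient u ∈ T n := hT ▸ Set.mem_image_of_mem _ hu
  obtain ⟨u', hu', heq⟩ := hmem
  rw [← Language.mem_leftQuotient, ← heq]
  exact h n u' hu' v hv

end

theorem Model.IsRegular.satisfies_separatingSequent {M : Model.{u}} (hM : M.IsRegular) :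
    M.Satisfies separatingSequent := by
  refine (M.satisfies_testSequent _ _).2 fun h => ?_
  simp only [List.forall_mem_cons, Model.interp, nil_mem_leftDiv] at h
  obtain ⟨h1, h2, h3, h4, h5, h6, h7, h8, -⟩ := h
  obtain ⟨r, hr⟩ := hM 2
  obtain ⟨m, n, hmn, hE⟩ := exists_lt_append_mem (hr ▸ r.finite_range_leftQuotient)
    fun n _ hu _ hv => append_mem_of_mem_pow h1 h2 n hu hv
  refine mem_of_pow_append_mem h8 n fun v hv => mem_of_pow_append_mem h7 m fun u hu => ?_
  rw [List.append_nil]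
  exact h6 ⟨hE u hu v hv, append_mem_of_mem_pow_of_lt h3 h4 h5 hmn hu hv⟩

/-- The word `aᵐbⁿ`. -/
def blockWord (m n : ℕ) : List (ULift.{u} Bool) :=
  List.replicate m ⟨true⟩ ++ List.replicate n ⟨false⟩

theorem blockWord_append (m n : ℕ) : blockWord.{u} m n ++ [⟨false⟩] = blockWord m (n + 1) := by
  simp [blockWord, List.replicate_succ']

theorem blockWord_injective {m n m' n' : ℕ} (h : blockWord.{u} m n = blockWord m' n') :
    m = m' ∧ n = n' := by
  have h1 := congrArg (List.countP fun x => x.down) h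
  have h2 := congrArg (List.countP fun x => !x.down) h
  simpa [blockWord, List.countP_replicate] using And.intro h1 h2

/-- The model with `P = {a}`, `Q = {b}`, `E = {aⁿbⁿ}`, `F = {aᵐbⁿ | m < n}` and `R = ∅`. -/
def blockModel : Model.{u} where
  Alphabet := ULift Bool
  val
    | 0 => {[⟨true⟩]}
    | 1 => {[⟨false⟩]}
    | 2 => {w : List (ULift Bool) | ∃ n, blockWord n n = w}
    | 3 => {w : List (ULift Bool) | ∃ m n, m < n ∧ blockWord m n = w}
    | _ => 0

theorem not_satisfies_blockModel : ¬ blockModel.{u}.Satisfies separatingSequent := by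
  intro h
  refine Language.notMem_zero [] ((blockModel.satisfies_testSequent _ _).1 h ?_)
  simp only [List.forall_mem_cons, Model.interp, nil_mem_leftDiv]
  refine ⟨⟨0, rfl⟩, ?_, ?_, ?_, ?_, ?_, ?_, ?_, by simp⟩
  · rintro _ rfl _ ⟨n, rfl⟩ _ rfl
    exact ⟨n + 1, congrArg (List.cons _) (blockWord_append _ _).symm⟩
  · rintro _ rfl
    exact ⟨0, 1, one_pos, rfl⟩
  · rintro _ rfl _ ⟨m, n, hmn, rfl⟩
    exact ⟨m, n + 1, by omega, (blockWord_append m n).symm⟩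
  · rintro _ rfl _ ⟨m, n, hmn, rfl⟩ _ rfl
    exact ⟨m + 1, n + 1, by omega, congrArg (List.cons _) (blockWord_append _ _).symm⟩
  · rintro _ ⟨⟨k, rfl⟩, m, n, hmn, hw⟩
    have := blockWord_injective hw
    omega
  -- As `P` is nonempty and `R = ∅`, the quotient `P\R` is empty; likewise for `Q`.
  · exact fun w hw => (hw [⟨true⟩] rfl).elim
  · exact fun w hw => (hw [⟨false⟩] rfl).elim

end Lambek

theorem theorem7 :
    (Lambek.Th {M : Lambek.Model.{u} | M.IsRegular} ≠
      Lambek.Th (Set.univ : Set Lambek.Model.{u})) ∧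
    (Lambek.Th {M : Lambek.Model.{u} | Finite M.Alphabet ∧ M.IsRegular} ≠
      Lambek.Th {M : Lambek.Model.{u} | Finite M.Alphabet}) := by
  constructor
  · intro h
    have hs : Lambek.separatingSequent ∈ Lambek.Th {M : Lambek.Model.{u} | M.IsRegular} :=
      fun M hM => hM.satisfies_separatingSequent
    rw [h] at hs
    exact Lambek.not_satisfies_blockModel (hs _ trivial)
  · intro h
    have hs : Lambek.separatingSequent ∈
        Lambek.Th {M : Lambek.Model.{u} | Finite M.Alphabet ∧ M.IsRegular} :=
      fun M hM => hM.2.satisfies_separatingSequent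
    rw [h] at hs
    exact Lambek.not_satisfies_blockModel (hs _ (inferInstanceAs (Finite (ULift Bool))))
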